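/- Let $n\ge 0$ and let $C_2M_n(\mathbb{C})=\{(m_1,m_2)\in M_n(\mathbb{C})^2 : m_1m_2=m_2m_1\}$ be the commuting variety with its reduced structure as a closed subvariety of $\mathbb{A}^{n^2}\times\mathbb{A}^{n^2}$; it is identified with $\mathrm{Rep}(\mathbb{C}[y_1,y_2],M_n(\mathbb{C}))$ by letting $(m_1,m_2)$ correspond to the $\mathbb{C}$-algebra homomorphism $y_1\mapsto m_1$, $y_2\mapsto m_2$. The group $\mathrm{GL}_n(\mathbb{C})$ acts on it by simultaneous conjugation. For such a pair let $\langle \mathbf{1},m_1,m_2\rangle\subset M_n(\mathbb{C})$ be the subalgebra generated by $\mathbf{1},m_1,m_2$, and let $\mathrm{Rep}(\mathbb{C}[y_1,y_2],M_n(\mathbb{C}))^{st}$ be the subset of those pairs for which $\mathbb{C}^n$ is isomorphic to $\langle \mathbf{1},m_1,m_2\rangle$ as a $\langle \mathbf{1},m_1,m_2\rangle$-module. Then $\mathrm{Rep}(\mathbb{C}[y_1,y_2],M_n(\mathbb{C}))^{st}$ is a Zariski open subset of $C_2M_n(\mathbb{C})$ which, as an open subvariety, is smooth over $\mathbb{C}$;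 it is $\mathrm{GL}_n(\mathbb{C})$-invariant; and the stabilizer in $\mathrm{GL}_n(\mathbb{C})$ of each of its points, as a closed algebraic subgroup, has dimension $n$. -/

import Mathlib

/-! ### Affine varieties over a field, given by their sets of points -/

/-- The coordinate ring of the (reduced) variety formed by a Zariski closed set `X` of points of
affine space: polynomials modulo those vanishing on `X`. -/
abbrev CoordRing {k σ : Type*} [Field k] (X : Set (σ → k)) : Type _ :=
  MvPolynomial σ k ⧸ MvPolynomial.vanishingIdeal k X

/-- Evaluation of a regular function on `X` at a point of `X`. -/
noncomputable def coordEval {k σ : Type*} [Field k] (X : Set (σ → k)) (x : X) :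
    CoordRing X →ₐ[k] k :=
  Ideal.Quotient.liftₐ (MvPolynomial.vanishingIdeal k X) (MvPolynomial.aeval (x : σ → k))
    (fun _ hf => hf x x.2)

/-- The closed point of `Spec (CoordRing X)` given by a point of `X`: the maximal ideal of the
regular functions that vanish at this point. -/
noncomputable def closedPoint {k σ : Type*} [Field k] (X : Set (σ → k)) (x : X) :
    PrimeSpectrum (CoordRing X) :=
  ⟨RingHom.ker (coordEval X x), RingHom.ker_isPrime _⟩

/-- `T` is a Zariski open subset of the variety `X` (with its reduced structure), and the open
subvariety with set of points `T` is smooth over `k`: there is an open subset `U` of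
`Spec (CoordRing X)` whose points coming from `X` are exactly those of `T`, and `Spec (CoordRing X)`
is smooth over `k` at every point of `U`. -/
def IsSmoothOpenSubvariety {k σ : Type*} [Field k] (X T : Set (σ → k)) : Prop :=
  T ⊆ X ∧ ∃ U : TopologicalSpace.Opens (PrimeSpectrum (CoordRing X)),
    (∀ x : X, closedPoint X x ∈ U ↔ (x : σ → k) ∈ T) ∧
    (U : Set (PrimeSpectrum (CoordRing X))) ⊆ Algebra.smoothLocus k (CoordRing X)

/-- The dimension of the variety `X`: the Krull dimension of its coordinate ring. -/
noncomputable def varietyDim {k σ : Type*} [Field k] (X : Set (σ → k)) : WithBot ℕ∞ :=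
  ringKrullDim (CoordRing X)

/-! ### Commuting pairs of matrices -/

/-- Pairs of complex `n × n` matrices. -/
abbrev MatPair (n : ℕ) : Type := Matrix (Fin n) (Fin n) ℂ × Matrix (Fin n) (Fin n) ℂ

/-- The matrix entries of a pair, as a point of affine space of dimension `n² + n²`. -/
def pairCoord {n : ℕ} (m : MatPair n) : (Fin n × Fin n) ⊕ (Fin n × Fin n) → ℂ :=
  Sum.elim (fun ij => m.1 ij.1 ij.2) (fun ij => m.2 ij.1 ij.2)

/-- The set of points of `Rep(ℂ[y₁, y₂], M_n(ℂ))`: the pair `(m₁, m₂)` of commuting matrices stands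
for the `ℂ`-algebra homomorphism `ℂ[y₁, y₂] → M_n(ℂ)` with `y₁ ↦ m₁` and `y₂ ↦ m₂`. -/
def commutingPairs (n : ℕ) : Set (MatPair n) := {m | m.1 * m.2 = m.2 * m.1}

/-- The subalgebra `⟨1, m₁, m₂⟩` of `M_n(ℂ)` generated by `1`, `m₁` and `m₂`. -/
def pairAlgebra {n : ℕ} (m : MatPair n) : Subalgebra ℂ (Matrix (Fin n) (Fin n) ℂ) :=
  Algebra.adjoin ℂ {1, m.1, m.2}

/-- The commuting pairs for which `ℂⁿ`, on which matrices act by `Matrix.mulVec`, is isomorphic to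
the algebra `⟨1, m₁, m₂⟩` as an `⟨1, m₁, m₂⟩`-module. -/
def stablePairs (n : ℕ) : Set (MatPair n) :=
  {m | m ∈ commutingPairs n ∧ Nonempty ((Fin n → ℂ) ≃ₗ[pairAlgebra m] pairAlgebra m)}

/-! ### The action of the general linear group -/

/-- `GL_n(ℂ)`, written as `ConjAct` so that it acts on matrices by conjugation `m ↦ g m g⁻¹`, and
hence diagonally on pairs of matrices. -/
abbrev ConjGL (n : ℕ) : Type := ConjAct (Matrix (Fin n) (Fin n) ℂ)ˣ

/-- The closed embedding of `GL_n(ℂ)` in affine space of dimension `n² + 1`: the entries of `g`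
together with `(det g)⁻¹`. -/
noncomputable def glCoord {n : ℕ} (g : ConjGL n) : Option (Fin n × Fin n) → ℂ
  | none => (Matrix.det (ConjAct.ofConjAct g).val)⁻¹
  | some ij => (ConjAct.ofConjAct g).val ij.1 ij.2

/-! A pair is stable exactly when it has a cyclic vector `v`: the preimage of `1` under an
isomorphism from `ℂⁿ` to the algebra is one. Conversely `z ↦ z v` is injective on the algebra, since
a matrix commuting with the pair is determined by its value on `v`. Cyclicity of `v` means that some
`n` of the vectors `xⁱ yʲ v` form a basis, that is, that a Krylov determinant is nonzero
(`mem_stablePairs_iff_krylov`). This gives openness, and invariance because `g` carries `v` to `g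
v`. The stabilizer is the group of units of the commutant, which evaluation at `v` identifies
linearly with `ℂⁿ`: it is a nonempty principal open subset of an affine `n`-space.

Smoothness is infinitesimal lifting on the scheme cut out by the commutator entries. If `x, y`
commute modulo a square-zero ideal `I`, the obstruction `c = [x, y]` must be written as `[x, b] +
[a, y]` with `a, b` over `I`. Over a field, the trace form makes the commutant orthogonal to all
such brackets; with a cyclic vector it is spanned by the monomials `xⁱ yʲ`, and `tr (c xⁱ yʲ) = 0`
in characteristic zero. `exists_commute_sub` carries this out over any base with explicit matrices.
Finally, smooth algebras over a field are reduced, so on these open sets the scheme and the reduced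
variety coincide. -/

open scoped TensorProduct

/-! ### Reducedness of smooth algebras over a field -/

/-- A smooth algebra over a field is reduced: a nilpotent `s` makes `s ⊗ X` integral over `S`,
and `S ⊗ K = S` is integrally closed in `S ⊗ K[X]` because `K` is so in `K[X]`. -/
theorem Algebra.Smooth.isReduced_of_field (K S : Type*) [Field K] [CommRing S] [Algebra K S]
    [Algebra.Smooth K S] : IsReduced S := by
  refine ⟨fun s hs => ?_⟩
  have hint : IsIntegral S (s ⊗ₜ[K] (Polynomial.X : Polynomial K)) := by
    obtain ⟨m, hm⟩ := hs
    refine ⟨Polynomial.X ^ m, Polynomial.monic_X_pow m, ?_⟩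
    simp [Algebra.TensorProduct.tmul_pow, hm]
  obtain ⟨t, ht⟩ :=
    (TensorProduct.toIntegralClosure_bijective_of_smooth (R := K) (S := S)
      (B := Polynomial K)).2 ⟨_, hint⟩
  -- The coefficient of `X` vanishes on elements integral over `K`, which are constants, but
  -- recovers `s` from `s ⊗ X`.
  let ev : Polynomial K →ₗ[K] K := Polynomial.lcoeff K 1
  let φ : S ⊗[K] Polynomial K →ₗ[K] S ⊗[K] K := _root_.TensorProduct.map LinearMap.id ev
  have hφ : ∀ t : S ⊗[K] integralClosure K (Polynomial K),
      φ (TensorProduct.toIntegralClosure K S (Polynomial K) t) = 0 := by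
    intro t
    induction t with
    | zero => simp
    | add a b ha hb => simp [ha, hb]
    | tmul a b =>
      have hb : ev b = 0 := by
        obtain ⟨q, hq, hqb⟩ := b.2
        replace hqb : q.comp b = 0 := hqb
        rcases Polynomial.comp_eq_zero_iff.mp hqb with h | ⟨-, h⟩
        · exact absurd h hq.ne_zero
        · rw [Polynomial.lcoeff_apply, h, Polynomial.coeff_C_succ]
      simp [φ, TensorProduct.toIntegralClosure, hb]
  have h := hφ t
  rw [ht] at h
  simpa [φ, ev] using congrArg (_root_.TensorProduct.rid K S) h

/-! ### Commuting lifts of matrices -/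

section Bracket

variable {M : Type*} [Ring M]

/-- The elements `[x, b] + [a, y]` with `a` and `b` in the two-sided ideal `J`: the tangent
directions of the commutator `[x, y]` along `J`. -/
def bracketRange (J : Ideal M) (x y : M) : AddSubgroup M where
  carrier := {c | ∃ a ∈ J, ∃ b ∈ J, c = (x * b - b * x) + (a * y - y * a)}
  zero_mem' := ⟨0, J.zero_mem, 0, J.zero_mem, by simp⟩
  add_mem' := by
    rintro _ _ ⟨a, ha, b, hb, rfl⟩ ⟨a', ha', b', hb', rfl⟩
    exact ⟨a + a', J.add_mem ha ha', b + b', J.add_mem hb hb', by noncomm_ring⟩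
  neg_mem' := by
    rintro _ ⟨a, ha, b, hb, rfl⟩
    exact ⟨-a, J.neg_mem ha, -b, J.neg_mem hb, by noncomm_ring⟩

variable {J : Ideal M} [J.IsTwoSided] {x y : M}

/-- Telescoping: `[xⁱ⁺¹, c] = [xⁱ, x c] + [x, c xⁱ]`, and `J` absorbs the extra factors. -/
theorem pow_left_bracket_mem_bracketRange (i : ℕ) {c : M} (hc : c ∈ J) :
    x ^ i * c - c * x ^ i ∈ bracketRange J x y := by
  induction i generalizing c with
  | zero => simp
  | succ i ih =>
    have h : x ^ (i + 1) * c - c * x ^ (i + 1) =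
        (x ^ i * (x * c) - (x * c) * x ^ i) + (x * (c * x ^ i) - (c * x ^ i) * x) := by
      rw [pow_succ]
      noncomm_ring
    rw [h]
    exact add_mem (ih (J.mul_mem_left _ hc))
      ⟨0, J.zero_mem, c * x ^ i, J.mul_mem_right _ hc, by simp⟩

theorem pow_right_bracket_mem_bracketRange (i : ℕ) {c : M} (hc : c ∈ J) :
    y ^ i * c - c * y ^ i ∈ bracketRange J x y := by
  induction i generalizing c with
  | zero => simp
  | succ i ih =>
    have h : y ^ (i + 1) * c - c * y ^ (i + 1) =
        (y ^ i * (y * c) - (y * c) * y ^ i) + (y * (c * y ^ i) - (c * y ^ i) * y) := by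
      rw [pow_succ]
      noncomm_ring
    rw [h]
    exact add_mem (ih (J.mul_mem_left _ hc))
      ⟨-(c * y ^ i), J.neg_mem (J.mul_mem_right _ hc), 0, J.zero_mem, by noncomm_ring⟩

theorem monomial_bracket_mem_bracketRange (i j : ℕ) {c : M} (hc : c ∈ J) :
    x ^ i * y ^ j * c - c * (x ^ i * y ^ j) ∈ bracketRange J x y := by
  have h : x ^ i * y ^ j * c - c * (x ^ i * y ^ j) =
      (x ^ i * (y ^ j * c) - (y ^ j * c) * x ^ i) +
        (y ^ j * (c * x ^ i) - (c * x ^ i) * y ^ j) := by noncomm_ring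
  rw [h]
  exact add_mem (pow_left_bracket_mem_bracketRange _ (J.mul_mem_left _ hc))
    (pow_right_bracket_mem_bracketRange _ (J.mul_mem_right _ hc))

theorem pow_right_bracket_mem (h : x * y - y * x ∈ J) (j : ℕ) : x * y ^ j - y ^ j * x ∈ J := by
  induction j with
  | zero => simp
  | succ j ih =>
    have e : x * y ^ (j + 1) - y ^ (j + 1) * x =
        (x * y ^ j - y ^ j * x) * y + y ^ j * (x * y - y * x) := by
      rw [pow_succ]; noncomm_ring
    rw [e]
    exact J.add_mem (J.mul_mem_right _ ih) (J.mul_mem_left _ h)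

theorem monomial_bracket_left_mem (h : x * y - y * x ∈ J) (i j : ℕ) :
    x * (x ^ i * y ^ j) - x ^ i * y ^ j * x ∈ J := by
  have e : x * (x ^ i * y ^ j) - x ^ i * y ^ j * x = x ^ i * (x * y ^ j - y ^ j * x) := by
    rw [← mul_assoc, ← pow_succ', pow_succ]; noncomm_ring
  rw [e]
  exact J.mul_mem_left _ (pow_right_bracket_mem h j)

theorem monomial_bracket_right_mem (h : x * y - y * x ∈ J) (i j : ℕ) :
    y * (x ^ i * y ^ j) - x ^ i * y ^ j * y ∈ J := by
  have h' : y * x - x * y ∈ J := by simpa using J.neg_mem h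
  have e : y * (x ^ i * y ^ j) - x ^ i * y ^ j * y = (y * x ^ i - x ^ i * y) * y ^ j := by
    rw [mul_assoc (x ^ i), ← pow_succ, pow_succ']; noncomm_ring
  rw [e]
  exact J.mul_mem_right _ (pow_right_bracket_mem h' i)

end Bracket

namespace Matrix

variable {B ι : Type*} [CommRing B] [Fintype ι] [DecidableEq ι]

instance (I : Ideal B) : (I.matrix ι).IsTwoSided where
  mul_mem_of_left b ha := by
    rw [Ideal.mem_matrix] at ha ⊢
    intro i j
    exact Ideal.sum_mem _ fun k _ => I.mul_mem_right _ (ha i k)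

theorem mul_eq_zero_of_mem_matrix {I : Ideal B} (hI : I ^ 2 = ⊥) {a b : Matrix ι ι B}
    (ha : a ∈ I.matrix ι) (hb : b ∈ I.matrix ι) : a * b = 0 := by
  ext i j
  rw [Ideal.mem_matrix] at ha hb
  refine Finset.sum_eq_zero fun k _ => ?_
  have := Ideal.mul_mem_mul (ha i k) (hb k j)
  rwa [← pow_two, hI] at this

variable {I : Ideal B} {x y : Matrix ι ι B}

/-- By cyclicity of the trace, `tr ([xⁱ⁺¹, y] yʲ) = 0`. Expanding the bracket gives `i + 1` terms,
all equal to `tr ([x, y] xⁱ yʲ)`: next to a factor over `I`, powers of `x` and `y` may be reordered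
because `I² = 0`. Then divide by `i + 1`. -/
theorem trace_bracket_mul_monomial (hB : ∀ m : ℕ, IsUnit ((m + 1 : ℕ) : B)) (hI : I ^ 2 = ⊥)
    (hxy : x * y - y * x ∈ I.matrix ι) (i j : ℕ) :
    trace ((x * y - y * x) * (x ^ i * y ^ j)) = 0 := by
  -- The truncated exponent at `m = l = 0` is harmless, as its coefficient is `0`.
  have key : ∀ m l : ℕ, trace ((x ^ m * y - y * x ^ m) * (x ^ l * y ^ j)) =
      m * trace ((x * y - y * x) * (x ^ (m + l - 1) * y ^ j)) := by
    intro m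
    induction m with
    | zero => simp
    | succ m ih =>
      intro l
      have e : (x ^ (m + 1) * y - y * x ^ (m + 1)) * (x ^ l * y ^ j) =
          (x ^ m * y - y * x ^ m) * (x ^ (l + 1) * y ^ j) +
          x ^ m * ((x * y - y * x) * (x ^ l * y ^ j)) := by
        rw [pow_succ x m, pow_succ' x l]; noncomm_ring
      have h0 : (x * y - y * x) * (x ^ l * y ^ j) * x ^ m =
          (x * y - y * x) * (x ^ (m + l) * y ^ j) := by
        rw [← sub_eq_zero]
        have : (x * y - y * x) * (x ^ l * y ^ j) * x ^ m -
            (x * y - y * x) * (x ^ (m + l) * y ^ j) =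
            ((x * y - y * x) * x ^ l) * (y ^ j * x ^ m - x ^ m * y ^ j) := by
          rw [add_comm m l, pow_add]; noncomm_ring
        rw [this]
        refine mul_eq_zero_of_mem_matrix hI (Ideal.mul_mem_right _ _ hxy) ?_
        refine pow_right_bracket_mem ?_ m
        rw [← neg_sub]
        exact neg_mem (pow_right_bracket_mem hxy j)
      rw [e, trace_add, ih, trace_mul_comm (x ^ m), h0, ← add_assoc, Nat.add_sub_cancel,
        Nat.add_right_comm m 1 l, Nat.add_sub_cancel]
      push_cast; ring
  have h := key (i + 1) 0
  have h0 : trace ((x ^ (i + 1) * y - y * x ^ (i + 1)) * (x ^ 0 * y ^ j)) = 0 := by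
    rw [pow_zero, one_mul, sub_mul, trace_sub, mul_assoc, mul_assoc, trace_mul_comm y, mul_assoc,
      ← pow_succ, ← pow_succ', sub_self]
  rw [h0, add_zero, Nat.add_sub_cancel] at h
  exact (hB i).mul_right_eq_zero.mp h.symm

/-- Invariance of the trace form: `tr ([x, b] p) = -tr (b [x, p])`, and for a monomial `p` both `b`
and `[x, p]` have entries in `I`. -/
theorem trace_mul_monomial_of_mem_bracketRange (hI : I ^ 2 = ⊥)
    (hxy : x * y - y * x ∈ I.matrix ι) {c : Matrix ι ι B}
    (hc : c ∈ bracketRange (I.matrix ι) x y) (i j : ℕ) :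
    trace (c * (x ^ i * y ^ j)) = 0 := by
  obtain ⟨a, ha, b, hb, rfl⟩ := hc
  have h1 : trace ((x * b - b * x) * (x ^ i * y ^ j)) = 0 := by
    have : trace ((x * b - b * x) * (x ^ i * y ^ j)) =
        -trace (b * (x * (x ^ i * y ^ j) - x ^ i * y ^ j * x)) := by
      rw [sub_mul, mul_sub, trace_sub, trace_sub, mul_assoc x, trace_mul_comm x]
      simp only [mul_assoc, neg_sub]
    rw [this, mul_eq_zero_of_mem_matrix hI hb (monomial_bracket_left_mem hxy i j), trace_zero,
      neg_zero]
  have h2 : trace ((a * y - y * a) * (x ^ i * y ^ j)) = 0 := by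
    have : trace ((a * y - y * a) * (x ^ i * y ^ j)) =
        trace (a * (y * (x ^ i * y ^ j) - x ^ i * y ^ j * y)) := by
      rw [sub_mul, mul_sub, trace_sub, trace_sub, mul_assoc y, trace_mul_comm y]
      simp only [mul_assoc]
    rw [this, mul_eq_zero_of_mem_matrix hI ha (monomial_bracket_right_mem hxy i j), trace_zero]
  rw [add_mul, trace_add, h1, h2, add_zero]

/-- The matrix whose `k`-th column is `x ^ i * y ^ j` applied to `v`, where `(i, j) = e k`. -/
def krylov (x y : Matrix ι ι B) (v : ι → B) (e : ι → ℕ × ℕ) : Matrix ι ι B :=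
  of fun i k => ((x ^ (e k).1 * y ^ (e k).2) *ᵥ v) i

theorem map_krylov {B' : Type*} [CommRing B'] (f : B →+* B') (v : ι → B) (e : ι → ℕ × ℕ) :
    (krylov x y v e).map f = krylov (x.map f) (y.map f) (f ∘ v) e := by
  ext i k
  simp only [krylov, map_apply, of_apply, RingHom.map_mulVec, Matrix.map_mul, Matrix.map_pow]

theorem krylov_mul_eq_sum (v : ι → B) (e : ι → ℕ × ℕ) (w : Matrix ι ι B) :
    krylov x y v e * w = ∑ k, x ^ (e k).1 * y ^ (e k).2 * vecMulVec v (w k) := by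
  ext i j
  simp only [mul_apply, mul_vecMulVec, sum_apply, vecMulVec_apply, krylov, of_apply]

/-- Two matrices that commute modulo a square-zero ideal and have a cyclic vector lift to
commuting matrices. -/
theorem exists_commute_sub (hB : ∀ m : ℕ, IsUnit ((m + 1 : ℕ) : B)) (hI : I ^ 2 = ⊥)
    (hxy : x * y - y * x ∈ I.matrix ι) {v : ι → B} {e : ι → ℕ × ℕ}
    (hdet : IsUnit (krylov x y v e).det) :
    ∃ a ∈ I.matrix ι, ∃ b ∈ I.matrix ι, (x - a) * (y - b) = (y - b) * (x - a) := by
  set c := x * y - y * x with hc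
  set G := krylov x y v e with hG
  set w := G⁻¹ * c with hw
  have hwI : w ∈ I.matrix ι := Ideal.mul_mem_left _ _ hxy
  set P : ι → Matrix ι ι B := fun k => x ^ (e k).1 * y ^ (e k).2 with hP
  -- Since `c = G w = ∑ Pₖ (v wₖᵀ)`, moving each `Pₖ` to the right changes `c` by brackets and
  -- leaves the rank-one matrix `v gᵀ`.
  set g : ι → B := ∑ k, w k ᵥ* P k with hg
  have hN : ∀ k, vecMulVec v (w k) ∈ I.matrix ι := fun k => by
    rw [Ideal.mem_matrix] at hwI ⊢
    exact fun i j => I.mul_mem_left _ (hwI k j)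
  have hcsum : c = ∑ k, P k * vecMulVec v (w k) := by
    rw [← krylov_mul_eq_sum, ← hG, hw, mul_nonsing_inv_cancel_left _ _ hdet]
  have hgsum : vecMulVec v g = ∑ k, vecMulVec v (w k) * P k := by
    simp only [vecMulVec_mul]
    ext i j
    simp only [vecMulVec_apply, hg, Finset.sum_apply, sum_apply, Finset.mul_sum]
  have hmem : c - vecMulVec v g ∈ bracketRange (I.matrix ι) x y := by
    rw [hcsum, hgsum, ← Finset.sum_sub_distrib]
    exact sum_mem fun k _ => monomial_bracket_mem_bracketRange _ _ (hN k)
  -- Pairing `c - v gᵀ` with `Pₖ` under the trace leaves only `g · (Pₖ v)`, and `Pₖ v` is the `k`-th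
  -- column of `G`.
  have hgG : g ᵥ* G = 0 := by
    funext k
    have h1 := trace_mul_monomial_of_mem_bracketRange hI hxy hmem (e k).1 (e k).2
    rw [sub_mul, trace_sub, trace_bracket_mul_monomial hB hI hxy, zero_sub, neg_eq_zero,
      trace_mul_comm, mul_vecMulVec, trace_vecMulVec, dotProduct_comm] at h1
    exact h1
  have hg0 : g = 0 := by
    have := congrArg (· ᵥ* G⁻¹) hgG
    simpa [vecMul_vecMul, mul_nonsing_inv _ hdet] using this
  rw [hg0, vecMulVec_zero, sub_zero] at hmem
  obtain ⟨a, ha, b, hb, hab⟩ := hmem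
  refine ⟨a, ha, b, hb, ?_⟩
  have h1 := mul_eq_zero_of_mem_matrix hI ha hb
  have h2 := mul_eq_zero_of_mem_matrix hI hb ha
  have : (x - a) * (y - b) - (y - b) * (x - a) =
      (x * y - y * x) - ((x * b - b * x) + (a * y - y * a)) + (a * b - b * a) := by noncomm_ring
  rw [← sub_eq_zero, this, h1, h2, ← hc, hab]
  simp

end Matrix

/-! ### The commuting scheme -/

/-- Inverting an element whose localization in `P ⧸ J` is smooth over a field gives a smooth
algebra also for the reduction `P ⧸ √J`. -/
theorem Algebra.FormallySmooth.away_quotient_radical {K P : Type*} [Field K] [CommRing P]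
    [IsNoetherianRing P] [Algebra K P] [Algebra.FiniteType K P] {J N : Ideal P}
    (hN : N = J.radical) (p : P)
    [Algebra.FormallySmooth K (Localization.Away (Ideal.Quotient.mk J p))] :
    Algebra.FormallySmooth K (Localization.Away (Ideal.Quotient.mk N p)) := by
  set S := Localization.Away (Ideal.Quotient.mk J p) with hS
  have hFP : Algebra.FinitePresentation K (P ⧸ J) := Algebra.FinitePresentation.of_finiteType.mp
    inferInstance
  have : Algebra.FinitePresentation (P ⧸ J) S :=
    IsLocalization.Away.finitePresentation (Ideal.Quotient.mk J p)
  have : Algebra.Smooth K S := ⟨inferInstance, .trans K (P ⧸ J) S⟩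
  have : IsReduced S := Algebra.Smooth.isReduced_of_field K S
  let q : P →ₐ[K] S := (IsScalarTower.toAlgHom K (P ⧸ J) S).comp (Ideal.Quotient.mkₐ K J)
  have hq : ∀ f : P, q f = algebraMap (P ⧸ J) S (Ideal.Quotient.mk J f) := fun _ => rfl
  have hJN : J ≤ N := hN ▸ Ideal.le_radical
  -- As `S` is reduced, `P → S` factors through `P ⧸ N`, so `S` is also the localization of `P ⧸ N`
  -- at `p`.
  have hker : ∀ f ∈ N, q f = 0 := fun f hf => by
    rw [hN] at hf
    obtain ⟨m, hm⟩ := hf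
    refine eq_zero_of_pow_eq_zero (n := m) ?_
    rw [← map_pow, hq, Ideal.Quotient.eq_zero_iff_mem.mpr hm, map_zero]
  let g : P ⧸ N →ₐ[K] S := Ideal.Quotient.liftₐ N q hker
  have hg : ∀ f : P, g (Ideal.Quotient.mk N f) = q f := fun _ => rfl
  let _ : Algebra (P ⧸ N) S := g.toRingHom.toAlgebra
  have halg : ∀ f : P ⧸ N, algebraMap (P ⧸ N) S f = g f := fun _ => rfl
  have : IsScalarTower K (P ⧸ N) S := .of_algebraMap_eq fun r => by
    rw [halg, AlgHom.commutes]
  have : IsLocalization.Away (Ideal.Quotient.mk N p) S := by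
    refine ⟨?_, ?_, ?_⟩
    · rintro ⟨_, m, rfl⟩
      simp only [map_pow, halg, hg, hq]
      exact (IsLocalization.Away.algebraMap_isUnit _).pow m
    · intro z
      obtain ⟨⟨f, ⟨_, m, rfl⟩⟩, h⟩ :=
        IsLocalization.surj (Submonoid.powers (Ideal.Quotient.mk J p)) z
      obtain ⟨f, rfl⟩ := Ideal.Quotient.mk_surjective f
      refine ⟨⟨Ideal.Quotient.mk N f, ⟨_, m, rfl⟩⟩, ?_⟩
      simp only [map_pow, halg, hg, hq] at h ⊢
      exact h
    · intro f₁ f₂ h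
      obtain ⟨f₁, rfl⟩ := Ideal.Quotient.mk_surjective f₁
      obtain ⟨f₂, rfl⟩ := Ideal.Quotient.mk_surjective f₂
      rw [halg, halg, hg, hg, hq, hq] at h
      obtain ⟨⟨_, m, rfl⟩, h⟩ :=
        (IsLocalization.eq_iff_exists (Submonoid.powers (Ideal.Quotient.mk J p)) S).mp h
      refine ⟨⟨_, m, rfl⟩, ?_⟩
      simp only [← map_pow, ← map_mul, Ideal.Quotient.mk_eq_mk_iff_sub_mem] at h ⊢
      exact hJN h
  exact .of_equiv ((IsLocalization.algEquiv (Submonoid.powers (Ideal.Quotient.mk N p)) S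
    (Localization.Away (Ideal.Quotient.mk N p))).restrictScalars K)

namespace Matrix

open MvPolynomial

variable (ι K : Type*) [CommRing K]

/-- The first of two generic matrices. -/
noncomputable def genericFst : Matrix ι ι (MvPolynomial ((ι × ι) ⊕ (ι × ι)) K) :=
  of fun i j => X (Sum.inl (i, j))

/-- The second of two generic matrices. -/
noncomputable def genericSnd : Matrix ι ι (MvPolynomial ((ι × ι) ⊕ (ι × ι)) K) :=
  of fun i j => X (Sum.inr (i, j))

/-- The ideal generated by the entries of the commutator of two generic matrices. -/
noncomputable def commutatorIdeal [Fintype ι] : Ideal (MvPolynomial ((ι × ι) ⊕ (ι × ι)) K) :=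
  Ideal.span (Set.range fun ij : ι × ι =>
    (genericFst ι K * genericSnd ι K - genericSnd ι K * genericFst ι K) ij.1 ij.2)

variable {ι K} {B : Type*} [CommRing B] [Algebra K B]

/-- The evaluation of polynomials at a pair of matrices. -/
noncomputable def pairEval (x y : Matrix ι ι B) : MvPolynomial ((ι × ι) ⊕ (ι × ι)) K →ₐ[K] B :=
  aeval (Sum.elim (fun ij => x ij.1 ij.2) (fun ij => y ij.1 ij.2))

theorem genericFst_map_pairEval (x y : Matrix ι ι B) :
    (genericFst ι K).map (pairEval x y) = x := by
  ext i j; simp [genericFst, pairEval]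

theorem genericSnd_map_pairEval (x y : Matrix ι ι B) :
    (genericSnd ι K).map (pairEval x y) = y := by
  ext i j; simp [genericSnd, pairEval]

variable [Fintype ι]

theorem commutatorIdeal_le_ker_iff (x y : Matrix ι ι B) :
    (∀ p ∈ commutatorIdeal ι K, pairEval x y p = 0) ↔ x * y = y * x := by
  have h : (genericFst ι K * genericSnd ι K - genericSnd ι K * genericFst ι K).map
      (pairEval x y : _ →ₐ[K] B) = x * y - y * x := by
    rw [Matrix.map_sub _ (map_sub _), Matrix.map_mul, Matrix.map_mul, genericFst_map_pairEval,
      genericSnd_map_pairEval]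
  rw [← sub_eq_zero, ← h]
  constructor
  · intro H
    ext i j
    exact H _ (Ideal.subset_span ⟨(i, j), rfl⟩)
  · intro H p hp
    suffices hle : commutatorIdeal ι K ≤ RingHom.ker (pairEval x y : _ →ₐ[K] B) from hle hp
    refine Ideal.span_le.mpr ?_
    rintro _ ⟨⟨i, j⟩, rfl⟩
    exact congrFun (congrFun H i) j

variable [DecidableEq ι]

/-- The determinant of the Krylov matrix of the generic matrices. -/
noncomputable def krylovDet (v : ι → K) (e : ι → ℕ × ℕ) : MvPolynomial ((ι × ι) ⊕ (ι × ι)) K :=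
  (krylov (genericFst ι K) (genericSnd ι K) (fun i => C (v i)) e).det

theorem pairEval_krylovDet (x y : Matrix ι ι B) (v : ι → K) (e : ι → ℕ × ℕ) :
    pairEval x y (krylovDet v e) = (krylov x y (fun i => algebraMap K B (v i)) e).det := by
  have h := map_krylov (x := genericFst ι K) (y := genericSnd ι K)
    (pairEval x y : _ →ₐ[K] B).toRingHom (fun i => C (v i)) e
  have hv : ((pairEval x y : _ →ₐ[K] B).toRingHom ∘ fun i => C (v i)) =
      fun i => algebraMap K B (v i) := by
    funext i
    simp [pairEval]
  rw [hv] at h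
  rw [krylovDet, AlgHom.map_det]
  refine congrArg det (h.trans ?_)
  congr 1
  · exact genericFst_map_pairEval x y
  · exact genericSnd_map_pairEval x y

/-- The lifting criterion for square-zero ideals: lift the matrix entries arbitrarily, then correct
them by `exists_commute_sub`. The Krylov determinant of the lift is a unit because it is one modulo
a nilpotent ideal. -/
theorem formallySmooth_away_krylovDet (hK : ∀ m : ℕ, IsUnit ((m + 1 : ℕ) : K)) (v : ι → K)
    (e : ι → ℕ × ℕ) : Algebra.FormallySmooth K
      (Localization.Away (Ideal.Quotient.mk (commutatorIdeal ι K) (krylovDet v e))) := by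
  set d := Ideal.Quotient.mk (commutatorIdeal ι K) (krylovDet v e)
  refine .of_comp_surjective fun B _ _ I hI f => ?_
  have hB : ∀ m : ℕ, IsUnit ((m + 1 : ℕ) : B) := fun m => by
    simpa using (hK m).map (algebraMap K B)
  let A := MvPolynomial ((ι × ι) ⊕ (ι × ι)) K ⧸ commutatorIdeal ι K
  let q : MvPolynomial ((ι × ι) ⊕ (ι × ι)) K →ₐ[K] B ⧸ I :=
    (f.comp (IsScalarTower.toAlgHom K A (Localization.Away d))).comp (Ideal.Quotient.mkₐ K _)
  have hq : ∀ p, q p = f (algebraMap A (Localization.Away d) (Ideal.Quotient.mk _ p)) :=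
    fun _ => rfl
  have hqd : IsUnit (q (krylovDet v e)) :=
    (IsLocalization.Away.algebraMap_isUnit (S := Localization.Away d) d).map f
  have hlift : ∀ p : MvPolynomial ((ι × ι) ⊕ (ι × ι)) K →ₐ[K] B,
      (Ideal.Quotient.mkₐ K I).comp p = q → IsUnit (p (krylovDet v e)) := fun p hp => by
    rw [← IsNilpotent.isUnit_quotient_mk_iff (I := I) ⟨2, hI⟩]
    rw [← hp] at hqd
    exact hqd
  obtain ⟨s, hs⟩ := (Ideal.Quotient.mk_surjective (I := I)).hasRightInverse
  let x : Matrix ι ι B := (genericFst ι K).map fun p => s (q p)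
  let y : Matrix ι ι B := (genericSnd ι K).map fun p => s (q p)
  have hcomp : ∀ a ∈ I.matrix ι, ∀ b ∈ I.matrix ι,
      (Ideal.Quotient.mkₐ K I).comp (pairEval (x - a) (y - b)) = q := by
    intro a ha b hb
    ext (⟨i, j⟩ | ⟨i, j⟩)
    · simp [pairEval, x, hs _, genericFst, Ideal.Quotient.eq_zero_iff_mem.mpr (ha i j)]
    · simp [pairEval, y, hs _, genericSnd, Ideal.Quotient.eq_zero_iff_mem.mpr (hb i j)]
  have hcomp0 := hcomp 0 (Ideal.zero_mem _) 0 (Ideal.zero_mem _)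
  rw [sub_zero, sub_zero] at hcomp0
  have hxy : x * y - y * x ∈ I.matrix ι := by
    have h : (genericFst ι K * genericSnd ι K - genericSnd ι K * genericFst ι K).map
        (pairEval x y : _ →ₐ[K] B) = x * y - y * x := by
      rw [Matrix.map_sub _ (map_sub _), Matrix.map_mul, Matrix.map_mul, genericFst_map_pairEval,
        genericSnd_map_pairEval]
    intro i j
    rw [← h]
    refine Ideal.Quotient.eq_zero_iff_mem.mp ?_
    refine (DFunLike.congr_fun hcomp0 _).trans ?_
    rw [hq, (Ideal.Quotient.eq_zero_iff_mem (I := commutatorIdeal ι K)).mpr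
      (Ideal.subset_span ⟨(i, j), rfl⟩), map_zero, map_zero]
  have hdet := hlift _ hcomp0
  rw [pairEval_krylovDet] at hdet
  obtain ⟨a, ha, b, hb, hab⟩ := exists_commute_sub hB hI hxy hdet
  let φ : A →ₐ[K] B := Ideal.Quotient.liftₐ _ (pairEval (x - a) (y - b))
    ((commutatorIdeal_le_ker_iff _ _).mpr hab)
  have hφ : ∀ p, φ (Ideal.Quotient.mk _ p) = pairEval (x - a) (y - b) p := fun _ => rfl
  have hφd : ∀ z : Submonoid.powers d, IsUnit (φ z) := by
    rintro ⟨_, m, rfl⟩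
    rw [map_pow]
    exact (hlift _ (hcomp a ha b hb)).pow m
  refine ⟨IsLocalization.liftAlgHom (M := Submonoid.powers d) (f := φ) hφd, ?_⟩
  refine AlgHom.coe_ringHom_injective (IsLocalization.ringHom_ext (Submonoid.powers d) ?_)
  refine Ideal.Quotient.ringHom_ext (RingHom.ext fun p => ?_)
  refine Eq.trans ?_ (DFunLike.congr_fun (hcomp a ha b hb) p)
  simp [← hφ]

end Matrix

/-! ### Krull dimension of principal open subsets of affine spaces -/

section Dimension

open MvPolynomial

variable {K : Type*} [Field K]

theorem ringKrullDim_localization_le {R : Type*} [CommRing R] (M : Submonoid R) :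
    ringKrullDim (Localization M) ≤ ringKrullDim R := by
  refine Order.krullDim_le_of_strictMono (PrimeSpectrum.comap (algebraMap R (Localization M))) ?_
  exact Monotone.strictMono_of_injective (fun _ _ h => Ideal.comap_mono h)
    (PrimeSpectrum.localization_comap_injective _ M)

/-- Setting the first variable to `t 0` is a surjection that kills the nonzerodivisor `X 0 - t 0`,
so each variable contributes at least one to the dimension; the point `t` keeps the specialized `D`
nonzero. -/
theorem le_ringKrullDim_away (n : ℕ) (D : MvPolynomial (Fin n) K) (t : Fin n → K)
    (hD : eval t D ≠ 0) : (n : WithBot ℕ∞) ≤ ringKrullDim (Localization.Away D) := by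
  induction n with
  | zero =>
    have hD0 : D ≠ 0 := by rintro rfl; simp at hD
    have : IsDomain (Localization.Away D) :=
      IsLocalization.isDomain_localization (powers_le_nonZeroDivisors_of_noZeroDivisors hD0)
    simpa using ringKrullDim_nonneg_of_nontrivial (R := Localization.Away D)
  | succ n ih =>
    have hD0 : D ≠ 0 := by rintro rfl; simp at hD
    let φ : MvPolynomial (Fin (n + 1)) K →ₐ[K] MvPolynomial (Fin n) K :=
      aeval (Fin.cons (C (t 0)) X)
    have hφ : Function.Surjective φ := fun p => ⟨rename Fin.succ p, by
      rw [aeval_rename, show (Fin.cons (C (t 0)) X : Fin (n + 1) → MvPolynomial (Fin n) K) ∘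
        Fin.succ = X from rfl, aeval_X_left_apply]⟩
    have hev : eval (Fin.tail t) (φ D) = eval t D := by
      have : (aeval (Fin.tail t) : MvPolynomial (Fin n) K →ₐ[K] K).comp φ = aeval t := by
        ext i
        refine Fin.cases ?_ (fun i => ?_) i <;> simp [φ, Fin.tail]
      have h := DFunLike.congr_fun this D
      rwa [AlgHom.comp_apply, aeval_eq_eval, aeval_eq_eval] at h
    have ih := ih (φ D) (Fin.tail t) (hev ▸ hD)
    let ψ : Localization.Away D →+* Localization.Away (φ D) :=
      IsLocalization.Away.map _ _ φ.toRingHom D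
    have hψ : ∀ p, ψ (algebraMap _ _ p) = algebraMap _ _ (φ p) := fun p =>
      IsLocalization.map_eq _ p
    have hψs : Function.Surjective ψ := by
      refine (IsLocalization.Away.map_surjective_iff (S := Localization.Away D)
        (Q := Localization.Away (φ D)) φ.toRingHom D).mpr fun p => ?_
      obtain ⟨q, rfl⟩ := hφ p
      exact ⟨q, 0, (one_mul _).symm.trans (by rw [pow_zero]; rfl)⟩
    have hle := powers_le_nonZeroDivisors_of_noZeroDivisors hD0
    have : IsDomain (Localization.Away D) := IsLocalization.isDomain_localization hle
    have hr : algebraMap (MvPolynomial (Fin (n + 1)) K) (Localization.Away D) (X 0 - C (t 0)) ∈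
        nonZeroDivisors (Localization.Away D) := by
      refine mem_nonZeroDivisors_of_ne_zero fun h => ?_
      rw [map_eq_zero_iff _ (IsLocalization.injective _ hle)] at h
      have := congrArg (eval (fun _ => t 0 + 1)) h
      simp at this
    have := ringKrullDim_succ_le_of_surjective ψ hψs hr (by
      rw [hψ, show φ (X 0 - C (t 0)) = 0 by simp [φ], map_zero])
    push_cast
    exact (add_le_add_left ih 1).trans this

theorem ringKrullDim_away_mvPolynomial (n : ℕ) (D : MvPolynomial (Fin n) K) (t : Fin n → K)
    (hD : eval t D ≠ 0) : ringKrullDim (Localization.Away D) = n := by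
  refine le_antisymm ((ringKrullDim_localization_le _).trans ?_) (le_ringKrullDim_away n D t hD)
  rw [MvPolynomial.ringKrullDim_of_isNoetherianRing, ringKrullDim_eq_zero_of_field]
  simp

end Dimension

/-! ### Invertible matrices in a linear subspace -/

section UnitsInSubspace

open MvPolynomial

variable {n : ℕ}

/-- Linear coordinates on `Z` identify its invertible elements with the locus `D ≠ 0` in affine
space, where `D` is the determinant; their coordinate ring is the polynomial ring with `D` inverted.
-/
theorem varietyDim_glCoord_submodule (Z : Submodule ℂ (Matrix (Fin n) (Fin n) ℂ)) (h1 : 1 ∈ Z) :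
    varietyDim (glCoord '' {g : ConjGL n | (ConjAct.ofConjAct g).val ∈ Z}) =
      Module.finrank ℂ Z := by
  set d := Module.finrank ℂ Z
  let a : Module.Basis (Fin d) ℂ Z := Module.finBasis ℂ Z
  let G : Matrix (Fin n) (Fin n) (MvPolynomial (Fin d) ℂ) :=
    Matrix.of fun i j => ∑ k, C ((a k).1 i j) * X k
  let D := G.det
  let pt : (Fin d → ℂ) → Matrix (Fin n) (Fin n) ℂ := fun t => (a.equivFun.symm t).1
  have hG : ∀ t i j, eval t (G i j) = pt t i j := fun t i j => by
    simp [G, pt, Module.Basis.equivFun_symm_apply, Matrix.sum_apply, mul_comm]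
  have hD : ∀ t, eval t D = (pt t).det := fun t => by
    rw [RingHom.map_det]
    congr 1
    ext i j
    exact hG t i j
  have hpt : ∀ z : Z, pt (a.equivFun z) = z := fun z => by
    simp only [pt, LinearEquiv.symm_apply_apply]
  set L := Localization.Away D
  let Φ : MvPolynomial (Option (Fin n × Fin n)) ℂ →ₐ[ℂ] L :=
    aeval fun o => o.elim (IsLocalization.Away.invSelf D) fun ij => algebraMap _ L (G ij.1 ij.2)
  have hDL : algebraMap _ L D * IsLocalization.Away.invSelf D = 1 :=
    IsLocalization.Away.mul_invSelf D
  have hunit : ∀ t, eval t D ≠ 0 → IsUnit (eval t D) := fun t ht => ht.isUnit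
  let ev : ∀ t, eval t D ≠ 0 → L →+* ℂ := fun t ht =>
    IsLocalization.Away.lift D (g := eval t) (hunit t ht)
  have hev : ∀ t ht p, ev t ht (algebraMap _ L p) = eval t p := fun t ht p =>
    IsLocalization.Away.lift_eq _ _ _
  have hevΦ : ∀ t (ht : eval t D ≠ 0) (g : ConjGL n), (ConjAct.ofConjAct g).val = pt t →
      ∀ f, ev t ht (Φ f) = aeval (glCoord g) f := by
    intro t ht g hg f
    have : (ev t ht).comp Φ.toRingHom = (aeval (glCoord g) : _ →ₐ[ℂ] ℂ).toRingHom := by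
      refine MvPolynomial.ringHom_ext (fun r => ?_) ?_
      · have := hev t ht (C r)
        simpa [Φ, IsScalarTower.algebraMap_apply ℂ (MvPolynomial (Fin d) ℂ) L] using this
      · rintro (_ | ⟨i, j⟩)
        · have := congrArg (ev t ht) hDL
          rw [map_mul, hev t ht, map_one] at this
          simp only [Φ, RingHom.comp_apply, AlgHom.toRingHom_eq_coe, RingHom.coe_coe, aeval_X,
            glCoord, Option.elim, hg, ← hD]
          exact eq_inv_of_mul_eq_one_right this
        · simp only [Φ, RingHom.comp_apply, AlgHom.toRingHom_eq_coe, RingHom.coe_coe, aeval_X,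
            glCoord, Option.elim, hg, hev, hG]
    exact DFunLike.congr_fun this f
  have hker : RingHom.ker Φ = vanishingIdeal ℂ
      (glCoord '' {g : ConjGL n | (ConjAct.ofConjAct g).val ∈ Z}) := by
    ext f
    rw [RingHom.mem_ker, mem_vanishingIdeal_iff]
    constructor
    · rintro hf _ ⟨g, hg, rfl⟩
      have hgt := hpt ⟨_, hg⟩
      have ht : eval (a.equivFun ⟨_, hg⟩) D ≠ 0 := by
        rw [hD, hgt]
        exact ((Matrix.isUnit_iff_isUnit_det _).mp (ConjAct.ofConjAct g).isUnit).ne_zero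
      rw [← hevΦ _ ht g hgt.symm, hf, map_zero]
    · intro hf
      obtain ⟨m, p, hp⟩ := IsLocalization.Away.surj D (Φ f)
      -- Multiplying by `D` removes the points where `Φ f` cannot be evaluated.
      have hpD : p * D = 0 := by
        refine MvPolynomial.funext fun t => ?_
        rw [map_mul, map_zero]
        by_cases ht : eval t D = 0
        · rw [ht, mul_zero]
        · have hu : IsUnit (pt t) := (Matrix.isUnit_iff_isUnit_det _).mpr (hD t ▸ hunit t ht)
          have h := hf _ ⟨ConjAct.toConjAct hu.unit, (a.equivFun.symm t).2, rfl⟩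
          rw [← hevΦ t ht _ rfl] at h
          have := congrArg (ev t ht) hp
          rw [map_mul, h, zero_mul, hev t ht] at this
          rw [← this, zero_mul]
      have hu : IsUnit (algebraMap _ L D) := IsLocalization.Away.algebraMap_isUnit D
      have : algebraMap _ L p = 0 := by
        rw [← hu.mul_left_eq_zero, ← map_mul, hpD, map_zero]
      rw [this, (hu.pow _).mul_left_eq_zero] at hp
      exact hp
  have hsurj : Function.Surjective Φ := by
    have hX : ∀ k : Fin d, algebraMap (MvPolynomial (Fin d) ℂ) L (X k) ∈ Φ.range := by
      intro k
      -- A coordinate on `Z` extends to all matrices, so it is a linear form in the matrix entries.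
      obtain ⟨l, hl⟩ := LinearMap.exists_extend (a.coord k)
      refine ⟨∑ i, ∑ j, C (l (Matrix.single i j 1)) * X (some (i, j)), ?_⟩
      have hsum : ∑ i, ∑ j, C (l (Matrix.single i j 1)) * G i j = X k := by
        refine MvPolynomial.funext fun t => ?_
        have h1 : l (pt t) = t k := by
          have := LinearMap.congr_fun hl (a.equivFun.symm t)
          rw [LinearMap.comp_apply, a.coord_equivFun_symm] at this
          exact this
        rw [eval_X, ← h1]
        conv_rhs => rw [Matrix.matrix_eq_sum_single (pt t)]
        simp only [map_sum, map_mul, eval_C, hG]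
        refine Finset.sum_congr rfl fun i _ => Finset.sum_congr rfl fun j _ => ?_
        rw [show Matrix.single i j (pt t i j) = pt t i j • Matrix.single i j (1 : ℂ) by simp,
          map_smul, smul_eq_mul, mul_comm]
      have hC : ∀ r : ℂ, algebraMap ℂ L r = algebraMap _ L (C r) := fun r =>
        IsScalarTower.algebraMap_apply ℂ (MvPolynomial (Fin d) ℂ) L r
      rw [← hsum]
      simp [Φ, hC]
    have hp : ∀ p : MvPolynomial (Fin d) ℂ, algebraMap _ L p ∈ Φ.range := by
      intro p
      induction p using MvPolynomial.induction_on with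
      | C r =>
        have : algebraMap _ L (C r) = algebraMap ℂ L r :=
          (IsScalarTower.algebraMap_apply ℂ (MvPolynomial (Fin d) ℂ) L r).symm
        rw [this]
        exact Φ.range.algebraMap_mem r
      | add p q hp hq => rw [map_add]; exact add_mem hp hq
      | mul_X p k hp => rw [map_mul]; exact mul_mem hp (hX k)
    intro z
    obtain ⟨m, p, hz⟩ := IsLocalization.Away.surj D z
    have hinv : IsLocalization.Away.invSelf D ∈ Φ.range := ⟨X none, by simp [Φ]⟩
    have : z = algebraMap _ L p * IsLocalization.Away.invSelf D ^ m := by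
      rw [← hz, mul_assoc, ← mul_pow, hDL, one_pow, mul_one]
    rw [this]
    exact mul_mem (hp p) (pow_mem hinv m)
  rw [varietyDim]
  change ringKrullDim (_ ⧸ vanishingIdeal ℂ _) = _
  rw [← hker, ringKrullDim_eq_of_ringEquiv
    (Ideal.quotientKerAlgEquivOfSurjective hsurj).toRingEquiv]
  refine ringKrullDim_away_mvPolynomial d D (a.equivFun ⟨1, h1⟩) ?_
  rw [hD, hpt]
  simp

end UnitsInSubspace

/-! ### Cyclic vectors of commuting pairs -/

namespace Matrix

variable {K ι : Type*} [Field K] [Fintype ι] [DecidableEq ι] {x y : Matrix ι ι K}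

theorem adjoin_le_span_monomials (hxy : Commute x y) {z : Matrix ι ι K}
    (hz : z ∈ Algebra.adjoin K {1, x, y}) :
    z ∈ Submodule.span K (Set.range fun e : ℕ × ℕ => x ^ e.1 * y ^ e.2) := by
  rw [← Subalgebra.mem_toSubmodule, Algebra.adjoin_eq_span] at hz
  refine Submodule.span_mono ?_ hz
  intro z hz
  induction hz using Submonoid.closure_induction with
  | mem z hz =>
    rcases hz with rfl | rfl | rfl
    · exact ⟨(0, 0), by simp⟩
    · exact ⟨(1, 0), by simp⟩
    · exact ⟨(0, 1), by simp⟩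
  | one => exact ⟨(0, 0), by simp⟩
  | mul z w _ _ hz hw =>
    obtain ⟨⟨i, j⟩, rfl⟩ := hz
    obtain ⟨⟨k, l⟩, rfl⟩ := hw
    refine ⟨(i + k, j + l), ?_⟩
    have h : y ^ j * x ^ k = x ^ k * y ^ j := (hxy.symm.pow_pow j k).eq
    simp only [pow_add]
    rw [mul_assoc, mul_assoc, ← mul_assoc (y ^ j), h, mul_assoc]

theorem monomial_mem_adjoin (i j : ℕ) : x ^ i * y ^ j ∈ Algebra.adjoin K {1, x, y} :=
  mul_mem (pow_mem (Algebra.subset_adjoin (by simp)) i)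
    (pow_mem (Algebra.subset_adjoin (by simp)) j)

theorem exists_krylov_det_ne_zero_iff (hxy : Commute x y) (v : ι → K) :
    (∃ e : ι → ℕ × ℕ, (krylov x y v e).det ≠ 0) ↔
      ∀ u, ∃ z ∈ Algebra.adjoin K {1, x, y}, z *ᵥ v = u := by
  constructor
  · rintro ⟨e, he⟩ u
    have hdet : IsUnit (krylov x y v e).det := he.isUnit
    set c := (krylov x y v e)⁻¹ *ᵥ u
    have hc : krylov x y v e *ᵥ c = u := by
      rw [mulVec_mulVec, mul_nonsing_inv _ hdet, one_mulVec]
    refine ⟨∑ k, c k • (x ^ (e k).1 * y ^ (e k).2),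
      sum_mem fun k _ => Subalgebra.smul_mem _ (monomial_mem_adjoin _ _) _, ?_⟩
    rw [← hc]
    ext i
    simp only [sum_mulVec, smul_mulVec, Finset.sum_apply, Pi.smul_apply, smul_eq_mul]
    exact Finset.sum_congr rfl fun k _ => mul_comm _ _
  · intro H
    let f : ℕ × ℕ → ι → K := fun e => (x ^ e.1 * y ^ e.2) *ᵥ v
    have hf : Submodule.span K (Set.range f) = ⊤ := by
      refine eq_top_iff.mpr fun u _ => ?_
      obtain ⟨z, hz, rfl⟩ := H u
      have h := Submodule.mem_map_of_mem (f := (mulVecBilin K K).flip v)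
        (adjoin_le_span_monomials hxy hz)
      rw [Submodule.map_span, ← Set.range_comp] at h
      exact h
    -- Extract a basis from the spanning family of monomials applied to `v`; its exponents give `e`.
    obtain ⟨κ, a, -, hspan, hli⟩ := exists_linearIndependent' K f
    let b : Module.Basis κ K (ι → K) := .mk hli (by rw [hspan, hf])
    let σ : ι ≃ κ := (Pi.basisFun K ι).indexEquiv b
    refine ⟨a ∘ σ, ?_⟩
    have hu : IsUnit (krylov x y v (a ∘ σ)) := by
      rw [← linearIndependent_cols_iff_isUnit]
      exact hli.comp σ σ.injective
    exact ((isUnit_iff_isUnit_det _).mp hu).ne_zero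

/-- Every vector is `p v` with `p` in the algebra, and `z p v = p z v = p w v = w p v`. -/
theorem eq_of_mulVec_eq_of_commute {v : ι → K} {z w : Matrix ι ι K}
    (hv : ∀ u, ∃ z ∈ Algebra.adjoin K {1, x, y}, z *ᵥ v = u)
    (hzx : Commute z x) (hzy : Commute z y) (hwx : Commute w x) (hwy : Commute w y)
    (h : z *ᵥ v = w *ᵥ v) : z = w := by
  have hcomm : ∀ {z p}, Commute z x → Commute z y → p ∈ Algebra.adjoin K {1, x, y} →
      Commute z p := fun h1 h2 hp =>
    Algebra.commute_of_mem_adjoin_of_forall_mem_commute hp (by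
      rintro _ (rfl | rfl | rfl)
      exacts [Commute.one_right _, h1, h2])
  refine ext_of_mulVec_single fun i => ?_
  obtain ⟨p, hp, hpv⟩ := hv (Pi.single i 1)
  rw [← hpv, mulVec_mulVec, mulVec_mulVec, (hcomm hzx hzy hp).eq, (hcomm hwx hwy hp).eq,
    ← mulVec_mulVec, h, mulVec_mulVec]

/-- The matrices that commute with both `x` and `y`. -/
def pairCommutant (x y : Matrix ι ι K) : Submodule K (Matrix ι ι K) :=
  Subalgebra.toSubmodule (Subalgebra.centralizer K {x, y})

theorem mem_pairCommutant {z : Matrix ι ι K} :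
    z ∈ pairCommutant x y ↔ Commute z x ∧ Commute z y := by
  rw [pairCommutant, Subalgebra.mem_toSubmodule, Subalgebra.mem_centralizer_iff]
  exact ⟨fun h => ⟨(h x (by simp)).symm, (h y (by simp)).symm⟩, fun h g hg => by
    rcases hg with rfl | rfl
    exacts [h.1.eq.symm, h.2.eq.symm]⟩

theorem mem_pairCommutant_of_mem_adjoin (hxy : Commute x y) {z : Matrix ι ι K}
    (hz : z ∈ Algebra.adjoin K {1, x, y}) : z ∈ pairCommutant x y := by
  refine mem_pairCommutant.mpr ⟨Commute.symm ?_, Commute.symm ?_⟩ <;>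
  refine Algebra.commute_of_mem_adjoin_of_forall_mem_commute hz ?_ <;>
  rintro _ (rfl | rfl | rfl)
  exacts [Commute.one_right _, Commute.refl _, hxy, Commute.one_right _, hxy.symm, Commute.refl _]

theorem finrank_pairCommutant (hxy : Commute x y) {v : ι → K}
    (hv : ∀ u, ∃ z ∈ Algebra.adjoin K {1, x, y}, z *ᵥ v = u) :
    Module.finrank K (pairCommutant x y) = Fintype.card ι := by
  let f : pairCommutant x y →ₗ[K] (ι → K) :=
    ((mulVecBilin K K).flip v).comp (pairCommutant x y).subtype
  have hf : Function.Bijective f := by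
    constructor
    · intro z w h
      obtain ⟨hzx, hzy⟩ := mem_pairCommutant.mp z.2
      obtain ⟨hwx, hwy⟩ := mem_pairCommutant.mp w.2
      exact Subtype.ext (eq_of_mulVec_eq_of_commute hv hzx hzy hwx hwy h)
    · intro u
      obtain ⟨z, hz, h⟩ := hv u
      exact ⟨⟨z, mem_pairCommutant_of_mem_adjoin hxy hz⟩, h⟩
  rw [(LinearEquiv.ofBijective f hf).finrank_eq, Module.finrank_fintype_fun_eq_card]

end Matrix

open Matrix

/-! ### Stable pairs -/

section StablePairs

variable {n : ℕ}

theorem mem_stablePairs_iff_cyclic {m : MatPair n} :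
    m ∈ stablePairs n ↔ Commute m.1 m.2 ∧
      ∃ v : Fin n → ℂ, ∀ u, ∃ z ∈ pairAlgebra m, z *ᵥ v = u := by
  refine and_congr_right fun hm => ?_
  replace hm : Commute m.1 m.2 := hm
  constructor
  · rintro ⟨φ⟩
    refine ⟨φ.symm 1, fun u => ⟨(φ u).1, (φ u).2, ?_⟩⟩
    change φ u • φ.symm 1 = u
    rw [← map_smul, smul_eq_mul, mul_one, LinearEquiv.symm_apply_apply]
  · rintro ⟨v, hv⟩
    let f : pairAlgebra m →ₗ[pairAlgebra m] (Fin n → ℂ) := LinearMap.toSpanSingleton _ _ v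
    refine ⟨(LinearEquiv.ofBijective f ⟨fun z w h => ?_, fun u => ?_⟩).symm⟩
    · obtain ⟨hzx, hzy⟩ := mem_pairCommutant.mp (mem_pairCommutant_of_mem_adjoin hm z.2)
      obtain ⟨hwx, hwy⟩ := mem_pairCommutant.mp (mem_pairCommutant_of_mem_adjoin hm w.2)
      exact Subtype.ext (eq_of_mulVec_eq_of_commute hv hzx hzy hwx hwy h)
    · obtain ⟨z, hz, h⟩ := hv u
      exact ⟨⟨z, hz⟩, h⟩

theorem mem_stablePairs_iff_krylov {m : MatPair n} :
    m ∈ stablePairs n ↔ m ∈ commutingPairs n ∧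
      ∃ (v : Fin n → ℂ) (e : Fin n → ℕ × ℕ), (krylov m.1 m.2 v e).det ≠ 0 := by
  rw [mem_stablePairs_iff_cyclic]
  exact and_congr_right fun hm => exists_congr fun v => (exists_krylov_det_ne_zero_iff hm v).symm

theorem smul_mem_stablePairs (g : ConjGL n) {m : MatPair n} (hm : m ∈ stablePairs n) :
    g • m ∈ stablePairs n := by
  rw [mem_stablePairs_iff_krylov] at hm ⊢
  obtain ⟨hc, v, e, h⟩ := hm
  set u := ConjAct.ofConjAct g with hu
  have hpow : ∀ (a : Matrix (Fin n) (Fin n) ℂ) (i : ℕ), (g • a) ^ i = g • a ^ i := fun a i =>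
    (smul_pow' g a i).symm
  refine ⟨?_, u.val *ᵥ v, e, ?_⟩
  · change g • m.1 * g • m.2 = g • m.2 * g • m.1
    rw [← smul_mul', ← smul_mul', show m.1 * m.2 = m.2 * m.1 from hc]
  · have : krylov (g • m).1 (g • m).2 (u.val *ᵥ v) e = u.val * krylov m.1 m.2 v e := by
      ext i k
      change (((g • m.1) ^ (e k).1 * (g • m.2) ^ (e k).2) *ᵥ (u.val *ᵥ v)) i = _
      rw [hpow, hpow, ← smul_mul', ConjAct.units_smul_def, ← hu, mulVec_mulVec,
        Units.inv_mul_cancel_right, ← mulVec_mulVec]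
      rfl
    rw [this, det_mul]
    exact mul_ne_zero ((isUnit_iff_isUnit_det _).mp u.isUnit).ne_zero h

theorem varietyDim_stabilizer {m : MatPair n} (hm : m ∈ stablePairs n) :
    varietyDim (glCoord '' (MulAction.stabilizer (ConjGL n) m : Set (ConjGL n))) = n := by
  obtain ⟨hc, v, hv⟩ := mem_stablePairs_iff_cyclic.mp hm
  have hset : (MulAction.stabilizer (ConjGL n) m : Set (ConjGL n)) =
      {g | (ConjAct.ofConjAct g).val ∈ pairCommutant m.1 m.2} := by
    ext g
    rw [SetLike.mem_coe, MulAction.mem_stabilizer_iff, Set.mem_ofPred_eq, mem_pairCommutant,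
      Prod.ext_iff, Prod.smul_fst, Prod.smul_snd, ConjAct.units_smul_def, ConjAct.units_smul_def,
      Units.mul_inv_eq_iff_eq_mul, Units.mul_inv_eq_iff_eq_mul]
    rfl
  rw [hset, varietyDim_glCoord_submodule _
    (mem_pairCommutant.mpr ⟨Commute.one_left _, Commute.one_left _⟩),
    finrank_pairCommutant hc hv, Fintype.card_fin]

theorem aeval_pairCoord (m : MatPair n)
    (p : MvPolynomial ((Fin n × Fin n) ⊕ (Fin n × Fin n)) ℂ) :
    MvPolynomial.aeval (pairCoord m) p = pairEval m.1 m.2 p := rfl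

theorem image_commutingPairs :
    pairCoord '' commutingPairs n =
      MvPolynomial.zeroLocus ℂ (commutatorIdeal (Fin n) ℂ) := by
  ext c
  constructor
  · rintro ⟨m, hm, rfl⟩
    exact (commutatorIdeal_le_ker_iff m.1 m.2).mpr hm
  · intro hc
    have h : pairCoord (of fun i j => c (Sum.inl (i, j)), of fun i j => c (Sum.inr (i, j))) = c := by
      funext s
      rcases s with ⟨i, j⟩ | ⟨i, j⟩ <;> rfl
    refine ⟨_, (commutatorIdeal_le_ker_iff (K := ℂ) _ _).mp fun p hp => ?_, h⟩
    rw [← aeval_pairCoord (_, _), h]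
    exact hc p hp

theorem pairCoord_injective : Function.Injective (pairCoord (n := n)) := by
  intro m m' h
  refine Prod.ext ?_ ?_
  · ext i j; exact congrFun h (Sum.inl (i, j))
  · ext i j; exact congrFun h (Sum.inr (i, j))

/-- The basic opens of the Krylov determinants cover the stable pairs. By the Nullstellensatz the
vanishing ideal is the radical of the commutator ideal, so smoothness passes from the scheme to the
variety without knowing that the commutator ideal is radical. -/
theorem isSmoothOpenSubvariety_stablePairs :
    IsSmoothOpenSubvariety (pairCoord '' commutingPairs n) (pairCoord '' stablePairs n) := by
  refine ⟨Set.image_mono fun m hm => hm.1, ?_⟩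
  set X := pairCoord '' commutingPairs n with hX
  let d : (Fin n → ℂ) × (Fin n → ℕ × ℕ) → CoordRing X := fun ve =>
    Ideal.Quotient.mk _ (krylovDet ve.1 ve.2)
  refine ⟨⨆ ve, PrimeSpectrum.basicOpen (d ve), ?_, ?_⟩
  · rintro ⟨_, m, hm, rfl⟩
    have hd : ∀ ve, closedPoint X ⟨pairCoord m, m, hm, rfl⟩ ∈ PrimeSpectrum.basicOpen (d ve) ↔
        (krylov m.1 m.2 ve.1 ve.2).det ≠ 0 := fun ve => by
      have h : coordEval X ⟨pairCoord m, m, hm, rfl⟩ (d ve) =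
          (krylov m.1 m.2 ve.1 ve.2).det := pairEval_krylovDet (K := ℂ) m.1 m.2 ve.1 ve.2
      rw [← h]
      rfl
    rw [TopologicalSpace.Opens.mem_iSup, pairCoord_injective.mem_set_image,
      mem_stablePairs_iff_krylov]
    simp only [hd, Prod.exists, hm, true_and]
  · have hN : MvPolynomial.vanishingIdeal ℂ X = (commutatorIdeal (Fin n) ℂ).radical := by
      rw [hX, image_commutingPairs, MvPolynomial.vanishingIdeal_zeroLocus_eq_radical]
    have hFP : Algebra.FinitePresentation ℂ (CoordRing X) :=
      Algebra.FinitePresentation.of_finiteType.mp inferInstance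
    rw [TopologicalSpace.Opens.coe_iSup]
    refine Set.iUnion_subset fun ve => ?_
    rw [Algebra.basicOpen_subset_smoothLocus_iff]
    have := formallySmooth_away_krylovDet (K := ℂ)
      (fun m => (Nat.cast_ne_zero.mpr m.succ_ne_zero).isUnit) ve.1 ve.2
    exact Algebra.FormallySmooth.away_quotient_radical hN (krylovDet ve.1 ve.2)

end StablePairs

theorem proposition4p3p3 (n : ℕ) :
    IsSmoothOpenSubvariety (pairCoord '' commutingPairs n) (pairCoord '' stablePairs n) ∧
    (∀ (g : ConjGL n), ∀ m ∈ stablePairs n, g • m ∈ stablePairs n) ∧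
    (∀ m ∈ stablePairs n,
      varietyDim (glCoord '' (MulAction.stabilizer (ConjGL n) m : Set (ConjGL n))) = n) :=
  ⟨isSmoothOpenSubvariety_stablePairs, fun g _ hm => smul_mem_stablePairs g hm,
    fun _ hm => varietyDim_stabilizer hm⟩
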